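/- A POVM with $d$ outcomes on a complex Hilbert space $H$ is a tuple $(M_z)_{0\le z<d}$ of positive bounded operators on $H$ with $\sum_z M_z=\mathbb 1$. A family of POVMs $(M_{z|x})$ is *compatible* if there are a POVM $(G_\lambda)_\lambda$ with finitely many outcomes and numbers $0\le p(z|x,\lambda)\le 1$ with $\sum_z p(z|x,\lambda)=1$ for all $x,\lambda$, such that $M_{z|x}=\sum_\lambda p(z|x,\lambda)\,G_\lambda$ for all $z,x$; otherwise it is *incompatible*. A coarse-graining sends the $d_x$-outcome POVM $(M_{z|x})_z$ to the POVM $\tilde M_{w|x}=\sum_{z:\,f_x(z)=w}M_{z|x}$, where $f_x:\{0,\dots,d_x-1\}\to\{0,\dots,e_x-1\}$ is a map that may depend on $x$. It is *nontrivial* if $\tilde M_{w|x}\neq\mathbb 1$ for all $w$ and all $x$, and *binary* if $e_x=2$ for all $x$. The family is *fully incompatible with respect to coarse-graining* if it is incompatible and remains incompatible after every nontrivial coarse-graining. Given two pairs of two-outcome POVMs, $(A_{a|x})$ on $H$ and $(B_{b|y})$ on a Hilbert space $K$ ($a,b,x,y\in\{0,1\}$), and a unit vector $\psi$ in the algebraic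 tensor product $H\otimes K$, put $p(a,b|x,y)=\langle\psi,(A_{a|x}\otimes B_{b|y})\psi\rangle$ and $E_{xy}=\sum_{a,b}(-1)^{a+b}p(a,b|x,y)$. These statistics *violate a CHSH inequality* if $\bigl|E_{00}+E_{01}+E_{10}+E_{11}-2E_{st}\bigr|>2$ for some $s,t\in\{0,1\}$. **Theorem.** Full incompatibility with respect to coarse-graining of any two measurements can be witnessed in a device-independent way by CHSH violations, one for each nontrivial binary coarse-graining. Precisely: 1. Let $M_{\cdot|0}$ and $M_{\cdot|1}$ be POVMs with $d_0$ and $d_1$ outcomes on a complex Hilbert space $H$. The pair is fully incompatible with respect to coarse-graining if and only if it has at least one nontrivial binary coarse-graining and, for every nontrivial binary coarse-graining $(\tilde M_{a|x})$ of it, there are $m\in\mathbb N$, a unit vector $\psi\in H\otimes\mathbb C^m$ and two two-outcome POVMs $(B_{b|0})_b$, $(B_{b|1})_b$ on $\mathbb C^m$ such that the statistics $\langle\psi,(\tilde M_{a|x}\otimes B_{b|y})\psi\rangle$ violate a CHSH inequality. 2. The witness does not depend on the inner working of the devices: whenever two two-outcome POVMs on any complex Hilbert space $H'$, together with two two-outcome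 POVMs on any complex Hilbert space $K'$ and any unit vector $\psi\in H'\otimes K'$, produce statistics that violate a CHSH inequality, the two POVMs on $H'$ are incompatible. -/

import Mathlib

open scoped TensorProduct

namespace CoarseGraining

/-- A quantum measurement (POVM) with outcomes `0, …, d - 1` on the Hilbert space `H`:
positive bounded operators that sum up to the identity. -/
structure POVM (H : Type*) [NormedAddCommGroup H] [InnerProductSpace ℂ H] [CompleteSpace H]
    (d : ℕ) where
  effect : Fin d → (H →L[ℂ] H)
  isPositive : ∀ z, (effect z).IsPositive
  sum_effect : ∑ z, effect z = 1

section Measurements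

variable {H : Type*} [NormedAddCommGroup H] [InnerProductSpace ℂ H] [CompleteSpace H]

/-- The coarse-graining of a POVM along `f`: outcome `z` is reported as `f z`. The map `f` is
the same thing as a stochastic map `c(w|z)` with all entries in `{0, 1}`, namely `c(w|z) = 1`
exactly if `f z = w`, so that the new effects are `∑ z, c(w|z) M_z`. -/
def POVM.coarseGrain {d e : ℕ} (M : POVM H d) (f : Fin d → Fin e) : POVM H e where
  effect w := ∑ z with f z = w, M.effect z
  isPositive w := by
    rw [← ContinuousLinearMap.nonneg_iff_isPositive]
    exact Finset.sum_nonneg fun z _ =>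
      (ContinuousLinearMap.nonneg_iff_isPositive _).2 (M.isPositive z)
  sum_effect := by
    rw [← M.sum_effect]
    exact Finset.sum_fiberwise Finset.univ f M.effect

/-- No outcome of the POVM occurs with certainty on all states. A coarse-graining is nontrivial
for a measurement if the resulting POVM has this property. -/
def POVM.IsNontrivial {d : ℕ} (M : POVM H d) : Prop :=
  ∀ z, M.effect z ≠ 1

/-- A family of POVMs is compatible if all its members arise from one parent POVM `G` by
classical post-processing `p x l z = p(z|x,l)`. -/
def Compatible {X : Type*} {d : X → ℕ} (M : ∀ x, POVM H (d x)) : Prop :=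
  ∃ (k : ℕ) (G : POVM H k) (p : ∀ x, Fin k → Fin (d x) → ℝ),
    (∀ x l z, 0 ≤ p x l z ∧ p x l z ≤ 1) ∧
    (∀ x l, ∑ z, p x l z = 1) ∧
    ∀ x z, (M x).effect z = ∑ l, (p x l z : ℂ) • G.effect l

/-- A family of POVMs is fully incompatible w.r.t. coarse-graining if it is incompatible and
remains so after all nontrivial coarse-grainings, which may differ from one member to another. -/
def FullyIncompatible {X : Type*} {d : X → ℕ} (M : ∀ x, POVM H (d x)) : Prop :=
  ¬ Compatible M ∧
    ∀ (e : X → ℕ) (f : ∀ x, Fin (d x) → Fin (e x)),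
      (∀ x, ((M x).coarseGrain (f x)).IsNontrivial) →
        ¬ Compatible fun x => (M x).coarseGrain (f x)

end Measurements

section Bell

variable {H K : Type*} [NormedAddCommGroup H] [InnerProductSpace ℂ H] [CompleteSpace H]
  [NormedAddCommGroup K] [InnerProductSpace ℂ K] [CompleteSpace K]

/-- The probability `p(a,b|x,y) = ⟨ψ, (A_{a|x} ⊗ B_{b|y}) ψ⟩` of the outcomes `a` and `b`
if the shared pure state is `ψ` and the settings are `x` and `y`. -/
noncomputable def behavior (A : Fin 2 → POVM H 2) (B : Fin 2 → POVM K 2) (ψ : H ⊗[ℂ] K)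
    (x y a b : Fin 2) : ℝ :=
  (inner ℂ ψ (TensorProduct.map ((A x).effect a).toLinearMap
    ((B y).effect b).toLinearMap ψ)).re

/-- The correlator `E_{xy} = ∑ (-1)^(a+b) p(a,b|x,y)` of a table of statistics. -/
noncomputable def correlator (p : Fin 2 → Fin 2 → Fin 2 → Fin 2 → ℝ) (x y : Fin 2) : ℝ :=
  ∑ a : Fin 2, ∑ b : Fin 2, (-1 : ℝ) ^ (a.val + b.val) * p x y a b

/-- Violation of at least one of the eight CHSH inequalities
`± (E₀₀ + E₀₁ + E₁₀ + E₁₁ - 2 E_{st}) ≤ 2`. -/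
def ViolatesCHSH (p : Fin 2 → Fin 2 → Fin 2 → Fin 2 → ℝ) : Prop :=
  ∃ s t : Fin 2, 2 < |(∑ x, ∑ y, correlator p x y) - 2 * correlator p s t|

end Bell

/-- The pair `A` of two-outcome measurements can violate a CHSH inequality: for a suitable
finite-dimensional second system, a suitable shared state and suitable two-outcome measurements
on the second system, the resulting statistics violate one. -/
def CanViolateCHSH {H : Type*} [NormedAddCommGroup H] [InnerProductSpace ℂ H] [CompleteSpace H]
    (A : Fin 2 → POVM H 2) : Prop :=
  ∃ (m : ℕ) (ψ : H ⊗[ℂ] EuclideanSpace ℂ (Fin m))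
    (B : Fin 2 → POVM (EuclideanSpace ℂ (Fin m)) 2),
    ‖ψ‖ = 1 ∧ ViolatesCHSH (behavior A B ψ)

end CoarseGraining

/-!
Write `a₀, a₁` for the `±1`-valued observables of two two-outcome POVMs. A parent POVM can be taken
of the form `(1 ± a₀ ± a₁ ± Z) / 4`, so the pair is compatible as soon as there is an operator `Z`
with `Z ≥ -(1 ∓ (a₀ + a₁))` and `Z ≤ 1 ∓ (a₀ - a₁)` (`compatible_of_correlation`). This is a linear
feasibility problem whose dual consists of four positive finite-rank operators `W₀, …, W₃` with
`W₀ + W₁ = W₂ + W₃` and negative total trace against `1 ∓ (a₀ + a₁)`, `1 ∓ (a₀ - a₁)`.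

* If no dual solution exists, M. Riesz's extension theorem yields a functional on finite-rank
  operators, that is, a quadratic form on `H`, which is bounded and hence an operator `Z`
  (`exists_functional_of_forall_balanced`, `exists_operator_of_functional`). The argument is purely
  algebraic, so the dimension of `H` plays no role.
* A dual solution is a CHSH violation: `W₀ + W₁` and `W₂ + W₃` are two decompositions of one and
  the same unnormalized state, and both can be steered to by two measurements on the second half
  of a purification of it. A small multiple of the identity on the span of the vectors involved
  makes the state invertible (`exists_steering`, `canViolateCHSH_of_balanced`).

Conversely a parent POVM is a local hidden variable, and local models satisfy the CHSH inequalities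
(`not_violatesCHSH_of_compatible`). The step from arbitrary to binary coarse-grainings rests on two
facts: coarse-graining preserves compatibility, and a POVM with an effect other than `0` and `1` has
a nontrivial binary coarse-graining, which asks for this single outcome
(`fullyIncompatible_of_binary`, `exists_effect_of_not_compatible`).
-/

open scoped TensorProduct

namespace CoarseGraining

open InnerProductSpace

/-! ### Expectation values of product operators -/

section Tensor

variable {H K : Type*} [NormedAddCommGroup H] [InnerProductSpace ℂ H]
  [NormedAddCommGroup K] [InnerProductSpace ℂ K]

lemma inner_tensor_smul_right (c : ℂ) (φ ψ : H ⊗[ℂ] K) :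
    inner ℂ φ (c • ψ) = c * inner ℂ φ ψ := inner_smul_right φ ψ c

lemma inner_tensor_smul_left (c : ℂ) (φ ψ : H ⊗[ℂ] K) :
    inner ℂ (c • φ) ψ = starRingEnd ℂ c * inner ℂ φ ψ := inner_smul_left φ ψ c

/-- The expectation value `⟨ψ, (A ⊗ B) ψ⟩` (its real part) as a bilinear form in the local
operators `A` and `B`. -/
noncomputable def expectation (ψ : H ⊗[ℂ] K) : (H →L[ℂ] H) →ₗ[ℝ] (K →L[ℂ] K) →ₗ[ℝ] ℝ :=
  LinearMap.mk₂ ℝ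
    (fun A B => (inner ℂ ψ (TensorProduct.map A.toLinearMap B.toLinearMap ψ)).re)
    (fun A A' B => by simp [TensorProduct.map_add_left, inner_add_right])
    (fun c A B => by
      have : (c • A).toLinearMap = (c : ℂ) • A.toLinearMap := by ext; simp
      rw [this, TensorProduct.map_smul_left, LinearMap.smul_apply, inner_tensor_smul_right,
        Complex.re_ofReal_mul, smul_eq_mul])
    (fun A B B' => by simp [TensorProduct.map_add_right, inner_add_right])
    (fun c A B => by
      have : (c • B).toLinearMap = (c : ℂ) • B.toLinearMap := by ext; simp
      rw [this, TensorProduct.map_smul_right, LinearMap.smul_apply, inner_tensor_smul_right,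
        Complex.re_ofReal_mul, smul_eq_mul])

lemma expectation_apply (ψ : H ⊗[ℂ] K) (A : H →L[ℂ] H) (B : K →L[ℂ] K) :
    expectation ψ A B =
      (inner ℂ ψ (TensorProduct.map A.toLinearMap B.toLinearMap ψ)).re := rfl

lemma expectation_smul_vector (c : ℝ) (ψ : H ⊗[ℂ] K) (A : H →L[ℂ] H) (B : K →L[ℂ] K) :
    expectation ((c : ℂ) • ψ) A B = c ^ 2 * expectation ψ A B := by
  simp only [expectation_apply, map_smul, inner_tensor_smul_left, inner_tensor_smul_right,
    Complex.conj_ofReal, ← mul_assoc, ← Complex.ofReal_mul, Complex.re_ofReal_mul, sq]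

lemma expectation_one_one (ψ : H ⊗[ℂ] K) : expectation ψ 1 1 = ‖ψ‖ ^ 2 := by
  have h : TensorProduct.map (1 : H →L[ℂ] H).toLinearMap (1 : K →L[ℂ] K).toLinearMap ψ = ψ :=
    congrArg (fun f => f ψ) (TensorProduct.map_id (R := ℂ) (M := H) (N := K))
  rw [expectation_apply, h]
  exact inner_self_eq_norm_sq (𝕜 := ℂ) ψ

variable [CompleteSpace H] [CompleteSpace K]

lemma inner_map_adjoint_right (A : H →L[ℂ] H) (B : K →L[ℂ] K) (φ ψ : H ⊗[ℂ] K) :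
    inner ℂ φ (TensorProduct.map (star A).toLinearMap (star B).toLinearMap ψ) =
      inner ℂ (TensorProduct.map A.toLinearMap B.toLinearMap φ) ψ := by
  induction φ with
  | zero => simp
  | add x y hx hy => rw [map_add, inner_add_left, inner_add_left, hx, hy]
  | tmul u v =>
    induction ψ with
    | zero => simp
    | add x y hx hy => rw [map_add, inner_add_right, inner_add_right, hx, hy]
    | tmul u' v' =>
      simp [ContinuousLinearMap.star_eq_adjoint, ContinuousLinearMap.adjoint_inner_right]

lemma behavior_eq_expectation (A : Fin 2 → POVM H 2) (B : Fin 2 → POVM K 2) (ψ : H ⊗[ℂ] K)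
    (x y a b : Fin 2) :
    behavior A B ψ x y a b = expectation ψ ((A x).effect a) ((B y).effect b) := rfl

lemma expectation_nonneg (ψ : H ⊗[ℂ] K) {A : H →L[ℂ] H} {B : K →L[ℂ] K}
    (hA : 0 ≤ A) (hB : 0 ≤ B) : 0 ≤ expectation ψ A B := by
  obtain ⟨C, rfl⟩ := CStarAlgebra.nonneg_iff_eq_star_mul_self.1 hA
  obtain ⟨D, rfl⟩ := CStarAlgebra.nonneg_iff_eq_star_mul_self.1 hB
  have h : TensorProduct.map (star C * C).toLinearMap (star D * D).toLinearMap ψ =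
      TensorProduct.map (star C).toLinearMap (star D).toLinearMap
        (TensorProduct.map C.toLinearMap D.toLinearMap ψ) :=
    LinearMap.congr_fun (TensorProduct.map_comp (star C).toLinearMap (star D).toLinearMap
      C.toLinearMap D.toLinearMap) ψ
  rw [expectation_apply, h, inner_map_adjoint_right]
  exact inner_self_nonneg (𝕜 := ℂ) (E := H ⊗[ℂ] K)

end Tensor

/-! ### The CHSH inequality for compatible measurements -/

section LocalBound

/-- The CHSH inequality for one value of the hidden variable. -/
lemma chsh_local_bound {α₀ α₁ β₀ β₁ r : ℝ} (h₀ : |α₀| ≤ 1) (h₁ : |α₁| ≤ 1)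
    (k₀ : |β₀| ≤ r) (k₁ : |β₁| ≤ r) : |α₀ * (β₀ + β₁) + α₁ * (β₀ - β₁)| ≤ 2 * r := by
  have e₀ : |α₀ * (β₀ + β₁)| ≤ |β₀ + β₁| := by
    rw [abs_mul]; exact mul_le_of_le_one_left (abs_nonneg _) h₀
  have e₁ : |α₁ * (β₀ - β₁)| ≤ |β₀ - β₁| := by
    rw [abs_mul]; exact mul_le_of_le_one_left (abs_nonneg _) h₁
  refine (abs_add_le _ _).trans ((add_le_add e₀ e₁).trans ?_)
  rw [abs_le] at k₀ k₁
  rcases abs_cases (β₀ + β₁) with h | h <;> rcases abs_cases (β₀ - β₁) with h' | h' <;> linarith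

variable {H K : Type*} [NormedAddCommGroup H] [InnerProductSpace ℂ H] [CompleteSpace H]
  [NormedAddCommGroup K] [InnerProductSpace ℂ K] [CompleteSpace K]

/-- A parent POVM is a local hidden variable: conditioned on its outcome, the result of the first
party is independent of what the second party does. -/
theorem not_violatesCHSH_of_compatible {A : Fin 2 → POVM H 2} (hA : Compatible A)
    (B : Fin 2 → POVM K 2) (ψ : H ⊗[ℂ] K) (hψ : ‖ψ‖ = 1) :
    ¬ ViolatesCHSH (behavior A B ψ) := by
  obtain ⟨k, G, p, hp, hp1, hAG⟩ := hA
  rintro ⟨s, t, hst⟩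
  refine absurd hst (not_lt.2 ?_)
  set q : Fin k → Fin 2 → Fin 2 → ℝ := fun l y b => expectation ψ (G.effect l) ((B y).effect b)
  set r : Fin k → ℝ := fun l => expectation ψ (G.effect l) 1
  have hq : ∀ l y b, 0 ≤ q l y b := fun l y b =>
    expectation_nonneg ψ ((ContinuousLinearMap.nonneg_iff_isPositive _).2 (G.isPositive l))
      ((ContinuousLinearMap.nonneg_iff_isPositive _).2 ((B y).isPositive b))
  have hqr : ∀ l y, q l y 0 + q l y 1 = r l := by
    intro l y
    have := (B y).sum_effect
    rw [Fin.sum_univ_two] at this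
    simp only [q, r, ← this, map_add]
  have hr : ∑ l, r l = 1 := by
    simp only [r]
    rw [← LinearMap.sum_apply, ← map_sum, G.sum_effect, expectation_one_one, hψ, one_pow]
  have hbeh : ∀ x y a b, behavior A B ψ x y a b = ∑ l, p x l a * q l y b := by
    intro x y a b
    have hc : ∀ l, (p x l a : ℂ) • G.effect l = p x l a • G.effect l := fun l => by
      ext; simp
    rw [behavior_eq_expectation, hAG]
    simp only [hc, map_sum, map_smul, LinearMap.sum_apply, LinearMap.smul_apply, smul_eq_mul, q]
  set α : Fin 2 → Fin k → ℝ := fun x l => p x l 0 - p x l 1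
  set β : Fin 2 → Fin k → ℝ := fun y l => q l y 0 - q l y 1
  have hα : ∀ x l, |α x l| ≤ 1 := by
    intro x l
    have h0 := hp x l 0
    have h1 := hp x l 1
    rw [abs_le]; constructor <;> simp only [α] <;> linarith
  have hβ : ∀ y l, |β y l| ≤ r l := by
    intro y l
    have h0 := hq l y 0
    have h1 := hq l y 1
    rw [abs_le, ← hqr l y]; constructor <;> simp only [β] <;> linarith
  have hcor : ∀ x y, correlator (behavior A B ψ) x y = ∑ l, α x l * β y l := by
    intro x y
    simp only [correlator, Fin.sum_univ_two, hbeh, Finset.mul_sum, ← Finset.sum_add_distrib]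
    refine Finset.sum_congr rfl fun l _ => ?_
    simp [α, β]
    ring
  have hbound : ∀ l, |(∑ x, ∑ y, α x l * β y l) - 2 * (α s l * β t l)| ≤ 2 * r l := by
    intro l
    -- The four inequalities differ by exchanging the two settings of either party.
    refine le_trans (le_of_eq ?_)
      (chsh_local_bound (hα (1 - s) l) (hα s l) (hβ (1 - t) l) (hβ t l))
    congr 1
    fin_cases s <;> fin_cases t <;> simp [Fin.sum_univ_two] <;> ring
  calc |(∑ x, ∑ y, correlator (behavior A B ψ) x y) - 2 * correlator (behavior A B ψ) s t|
      = |∑ l, ((∑ x, ∑ y, α x l * β y l) - 2 * (α s l * β t l))| := by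
        simp only [hcor, Fin.sum_univ_two, Finset.sum_sub_distrib, Finset.sum_add_distrib,
          Finset.mul_sum]
    _ ≤ ∑ l, 2 * r l := (Finset.abs_sum_le_sum_abs _ _).trans
        (Finset.sum_le_sum fun l _ => hbound l)
    _ = 2 := by rw [← Finset.mul_sum, hr, mul_one]

end LocalBound

/-! ### The dual of the compatibility problem -/

section Duality

variable {H : Type*} [NormedAddCommGroup H] [InnerProductSpace ℂ H]

/-- The finite-rank operator `∑ x, W x • |x⟩⟨x|` of a finitely supported weight on vectors. -/
noncomputable def mixture : (H →₀ ℝ) →ₗ[ℝ] (H →L[ℂ] H) :=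
  Finsupp.linearCombination ℝ fun x => rankOne ℂ x x

/-- The real part of the trace of `mixture W` against the operator `T`, that is, of
`∑ x, W x * ⟨x, T x⟩`. -/
noncomputable def weightedMean (T : H →L[ℂ] H) : (H →₀ ℝ) →ₗ[ℝ] ℝ :=
  Finsupp.linearCombination ℝ fun x => (inner ℂ x (T x)).re

lemma mixture_single (x : H) (c : ℝ) :
    mixture (Finsupp.single x c) = c • rankOne ℂ x x :=
  Finsupp.linearCombination_single ..

lemma weightedMean_single (T : H →L[ℂ] H) (x : H) (c : ℝ) :
    weightedMean T (Finsupp.single x c) = c * (inner ℂ x (T x)).re :=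
  Finsupp.linearCombination_single ..

/-- The pairs `(W, r)` for which the inequality `z (mixture W) ≤ r` follows by positive combination
from `z ≥ -M i` for `i = 0, 1` and `z ≤ M i` for `i = 2, 3` on rank-one projections. -/
noncomputable def constraintCone (M : Fin 4 → H →L[ℂ] H) : PointedCone ℝ ((H →₀ ℝ) × ℝ) where
  carrier := {p | ∃ W : Fin 4 → H →₀ ℝ, (∀ i, 0 ≤ W i) ∧
    mixture p.1 = mixture (W 2 + W 3 - (W 0 + W 1)) ∧ ∑ i, weightedMean (M i) (W i) ≤ p.2}
  zero_mem' := ⟨0, fun _ => le_rfl, by simp, by simp⟩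
  add_mem' := by
    rintro p q ⟨W, hW, hp, hr⟩ ⟨W', hW', hp', hr'⟩
    refine ⟨W + W', fun i => add_nonneg (hW i) (hW' i), ?_, ?_⟩
    · simp only [Prod.fst_add, map_add, hp, hp', map_sub, Pi.add_apply]
      abel
    · simp only [Pi.add_apply, map_add, Finset.sum_add_distrib, Prod.snd_add]
      exact add_le_add hr hr'
  smul_mem' := by
    rintro ⟨c, hc⟩ p ⟨W, hW, hp, hr⟩
    refine ⟨c • W, fun i => smul_nonneg hc (hW i), ?_, ?_⟩
    · change mixture (c • p.1) = _
      simp only [map_smul, hp, map_sub, map_add, Pi.smul_apply, smul_sub, smul_add]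
    · change _ ≤ c • p.2
      simp only [Pi.smul_apply, map_smul, ← Finset.smul_sum]
      exact smul_le_smul_of_nonneg_left hr hc

/-- Farkas alternative: if no balanced quadruple of positive finite-rank operators has a negative
trace against `M`, there is a functional between `-M 0, -M 1` and `M 2, M 3`. It is obtained by
M. Riesz's extension theorem, which needs no topology and hence no compactness. -/
theorem exists_functional_of_forall_balanced (M : Fin 4 → H →L[ℂ] H)
    (hM : ∀ W : Fin 4 → H →₀ ℝ, (∀ i, 0 ≤ W i) →
      mixture (W 0 + W 1) = mixture (W 2 + W 3) → 0 ≤ ∑ i, weightedMean (M i) (W i)) :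
    ∃ z : (H →L[ℂ] H) →ₗ[ℝ] ℝ, ∀ x : H,
      (0 ≤ (inner ℂ x (M 0 x)).re + z (rankOne ℂ x x) ∧
        0 ≤ (inner ℂ x (M 1 x)).re + z (rankOne ℂ x x)) ∧
      (0 ≤ (inner ℂ x (M 2 x)).re - z (rankOne ℂ x x) ∧
        0 ≤ (inner ℂ x (M 3 x)).re - z (rankOne ℂ x x)) := by
  let f : ((H →₀ ℝ) × ℝ) →ₗ.[ℝ] ℝ :=
    ⟨Submodule.prod ⊥ ⊤, (LinearMap.snd ℝ (H →₀ ℝ) ℝ).domRestrict _⟩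
  obtain ⟨g, hgf, hg⟩ := riesz_extension (constraintCone M) f
    (by
      rintro ⟨⟨w, r⟩, hw⟩ ⟨W, hW, hp, hr⟩
      have hw0 : w = 0 := hw.1
      change 0 ≤ r
      refine (hM W hW ?_).trans hr
      change mixture w = _ at hp
      rw [hw0, map_zero, map_sub] at hp
      exact (sub_eq_zero.1 hp.symm).symm)
    (by
      rintro ⟨w, r⟩
      let W : Fin 4 → H →₀ ℝ := ![w⁻, 0, w⁺, 0]
      refine ⟨⟨(0, ∑ i, weightedMean (M i) (W i) - r), by simp [f]⟩, W, ?_, ?_, ?_⟩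
      · intro i
        fin_cases i
        · exact negPart_nonneg w
        · exact le_rfl
        · exact posPart_nonneg w
        · exact le_rfl
      · simp only [Prod.fst_add, zero_add]
        congr 1
        simp [W, posPart_sub_negPart]
      · simp)
  have hgr : ∀ r : ℝ, g (0, r) = r := fun r => hgf ⟨(0, r), by simp [f]⟩
  have hsplit : ∀ w r, g (w, r) = g (w, 0) + r := by
    intro w r
    conv_rhs => rw [← hgr r, ← map_add]
    simp
  have hker : ∀ w, mixture w = 0 → 0 ≤ g (w, 0) := fun w hw =>
    hg _ ⟨0, fun _ => le_rfl, by simp [hw], by simp⟩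
  have hmem : -(g ∘ₗ LinearMap.inl ℝ (H →₀ ℝ) ℝ) ∈
      LinearMap.range (LinearMap.dualMap (mixture (H := H))) := by
    rw [LinearMap.range_dualMap_eq_dualAnnihilator_ker, Submodule.mem_dualAnnihilator]
    intro w hw
    have hw : mixture w = 0 := hw
    have h1 := hker w hw
    have h2 := hker (-w) (by rw [map_neg, hw, neg_zero])
    have h3 : g (-w, 0) = -g (w, 0) := by rw [← map_neg]; simp
    simp only [LinearMap.neg_apply, LinearMap.comp_apply, LinearMap.inl_apply]
    linarith
  obtain ⟨z, hz⟩ := hmem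
  have hzx : ∀ x, g (Finsupp.single x 1, 0) = - z (rankOne ℂ x x) := by
    intro x
    have := LinearMap.congr_fun hz (Finsupp.single x 1)
    rw [LinearMap.dualMap_apply, mixture_single, one_smul] at this
    rw [this]
    simp
  have hneg : ∀ x, g (-Finsupp.single x 1, 0) = z (rankOne ℂ x x) := by
    intro x
    rw [← neg_neg (z _), ← hzx, ← map_neg]; simp
  -- Each of the four inequalities comes from putting the unit weight at `x` into one slot.
  have hslot : ∀ (x : H) (i : Fin 4), ∀ w : H →₀ ℝ,
      w = (Pi.single i (Finsupp.single x 1) : Fin 4 → H →₀ ℝ) 2 +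
        (Pi.single i (Finsupp.single x 1) : Fin 4 → H →₀ ℝ) 3 -
        ((Pi.single i (Finsupp.single x 1) : Fin 4 → H →₀ ℝ) 0 +
        (Pi.single i (Finsupp.single x 1) : Fin 4 → H →₀ ℝ) 1) →
      0 ≤ (inner ℂ x (M i x)).re + g (w, 0) := by
    intro x i w hw
    rw [add_comm, ← hsplit]
    refine hg _ ⟨Pi.single i (Finsupp.single x 1), ?_, by rw [← hw], ?_⟩
    · exact Pi.single_nonneg.2 (Finsupp.single_nonneg.2 zero_le_one)
    · rw [Finset.sum_eq_single i]
      · simp [weightedMean_single]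
      · intro j _ hj
        simp [Pi.single_eq_of_ne hj]
      · simp
  refine ⟨z, fun x => ⟨⟨?_, ?_⟩, ?_, ?_⟩⟩
  · rw [← hneg]; exact hslot x 0 _ (by simp)
  · rw [← hneg]; exact hslot x 1 _ (by simp)
  · rw [sub_eq_add_neg, ← hzx]; exact hslot x 2 _ (by simp)
  · rw [sub_eq_add_neg, ← hzx]; exact hslot x 3 _ (by simp)

variable [CompleteSpace H]

/-- A real functional on operators that is bounded on rank-one projections is represented there
by a bounded operator. -/
theorem exists_operator_of_functional (z : (H →L[ℂ] H) →ₗ[ℝ] ℝ)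
    (hz : ∀ x : H, |z (rankOne ℂ x x)| ≤ ‖x‖ ^ 2) :
    ∃ Z : H →L[ℂ] H, ∀ x, inner ℂ (Z x) x = (z (rankOne ℂ x x) : ℂ) := by
  -- The complex-linear functional that agrees with `z` on self-adjoint operators.
  let f : (H →L[ℂ] H) →ₗ[ℝ] ℝ :=
    z ∘ₗ (selfAdjoint.submodule ℝ (H →L[ℂ] H)).subtype ∘ₗ realPart
  have hf : ∀ T, f T = z (realPart T : H →L[ℂ] H) := fun _ => rfl
  let h : (H →L[ℂ] H) →ₗ[ℂ] ℂ := Module.Dual.extendRCLike (𝕜 := ℂ) f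
  have hh : ∀ x, h (rankOne ℂ x x) = z (rankOne ℂ x x) := by
    intro x
    have hsa : IsSelfAdjoint (rankOne ℂ x x) := by
      simp [IsSelfAdjoint, ContinuousLinearMap.star_eq_adjoint]
    have h1 : f (rankOne ℂ x x) = z (rankOne ℂ x x) := by
      rw [hf, hsa.coe_realPart]
    have h2 : f (Complex.I • rankOne ℂ x x) = 0 := by
      rw [hf, realPart_I_smul, hsa.imaginaryPart]; simp
    have := Module.Dual.extendRCLike_apply (𝕜 := ℂ) f (rankOne ℂ x x)
    simp only [h1] at this
    rw [show h (rankOne ℂ x x) = _ from this]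
    have h3 : f ((RCLike.I : ℂ) • rankOne ℂ x x) = 0 := h2
    rw [h3]
    simp
  have hnorm : ∀ x, ‖h (rankOne ℂ x x)‖ ≤ ‖x‖ ^ 2 := by
    intro x
    rw [hh, Complex.norm_real]
    exact hz x
  have hunit : ∀ x y : H, ‖x‖ = 1 → ‖y‖ = 1 → ‖h (rankOne ℂ x y)‖ ≤ 4 := by
    intro x y hx hy
    have hpol : (4 : ℂ) • rankOne ℂ x y = rankOne ℂ (x + y) (x + y) -
        rankOne ℂ (x - y) (x - y) +
        Complex.I • rankOne ℂ (x + Complex.I • y) (x + Complex.I • y) -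
        Complex.I • rankOne ℂ (x - Complex.I • y) (x - Complex.I • y) := by
      ext v
      simp only [smul_apply, add_apply, sub_apply, rankOne_apply, inner_add_left, inner_sub_left,
        inner_smul_left, Complex.conj_I]
      match_scalars
      · linear_combination (2 * inner ℂ y v) * Complex.I_sq
      · linear_combination (-2 * inner ℂ x v) * Complex.I_sq
    have hle : ∀ v : H, ‖v‖ ≤ 2 → ‖h (rankOne ℂ v v)‖ ≤ 4 := fun v hv =>
      (hnorm v).trans (by nlinarith [norm_nonneg v])
    have hIy : ‖Complex.I • y‖ = 1 := by rw [norm_smul, Complex.norm_I, one_mul, hy]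
    have e1 := hle (x + y) ((norm_add_le _ _).trans (by linarith))
    have e2 := hle (x - y) ((norm_sub_le _ _).trans (by linarith))
    have e3 := hle (x + Complex.I • y) ((norm_add_le _ _).trans (by linarith))
    have e4 := hle (x - Complex.I • y) ((norm_sub_le _ _).trans (by linarith))
    have hmul : (4 : ℂ) * h (rankOne ℂ x y) = h (rankOne ℂ (x + y) (x + y)) -
        h (rankOne ℂ (x - y) (x - y)) +
        Complex.I * h (rankOne ℂ (x + Complex.I • y) (x + Complex.I • y)) -
        Complex.I * h (rankOne ℂ (x - Complex.I • y) (x - Complex.I • y)) := by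
      rw [← smul_eq_mul, ← map_smul, hpol]
      simp only [map_add, map_sub, map_smul, smul_eq_mul]
    have h4 : 4 * ‖h (rankOne ℂ x y)‖ ≤ 4 + 4 + 4 + 4 := by
      calc 4 * ‖h (rankOne ℂ x y)‖ = ‖(4 : ℂ) * h (rankOne ℂ x y)‖ := by simp
        _ ≤ _ := by
          rw [hmul]
          refine (norm_sub_le _ _).trans (add_le_add ((norm_add_le _ _).trans (add_le_add
            ((norm_sub_le _ _).trans (add_le_add e1 e2)) ?_)) ?_)
          · rw [norm_mul, Complex.norm_I, one_mul]; exact e3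
          · rw [norm_mul, Complex.norm_I, one_mul]; exact e4
    linarith
  have hbound : ∀ y x : H, ‖h (rankOne ℂ x y)‖ ≤ 4 * ‖y‖ * ‖x‖ := by
    intro y x
    rcases eq_or_ne x 0 with rfl | hx
    · simp
    rcases eq_or_ne y 0 with rfl | hy
    · simp
    have hx' := norm_ne_zero_iff.2 hx
    have hy' := norm_ne_zero_iff.2 hy
    have e := hunit ((‖x‖ : ℂ)⁻¹ • x) ((‖y‖ : ℂ)⁻¹ • y)
      (by simp [norm_smul, hx']) (by simp [norm_smul, hy'])
    simp only [map_smul, map_smulₛₗ, smul_apply, norm_mul,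
      smul_eq_mul, norm_inv, RCLike.norm_conj, Complex.norm_real, norm_norm, map_inv₀] at e
    field_simp at e
    linarith
  let B : H →ₗ⋆[ℂ] H →ₗ[ℂ] ℂ := LinearMap.mk₂'ₛₗ (starRingEnd ℂ) (RingHom.id ℂ)
    (fun y x => h (rankOne ℂ x y)) (by intros; simp) (by intros; simp) (by intros; simp)
    (by intros; simp)
  refine ⟨continuousLinearMapOfBilin (B.mkContinuous₂ 4 hbound), fun x => ?_⟩
  exact (continuousLinearMapOfBilin_apply _ x x).trans (hh x)

end Duality

/-! ### Dual solutions as CHSH violations -/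

section Violation

variable {H : Type*} [NormedAddCommGroup H] [InnerProductSpace ℂ H] [CompleteSpace H]

/-- The operator whose expectation is the mean of the outcome if `0` and `1` count as `1` and
`-1`. -/
noncomputable def POVM.observable (A : POVM H 2) : H →L[ℂ] H := A.effect 0 - A.effect 1

/-- The operators `1 ∓ (a₀ + a₁)` and `1 ∓ (a₀ - a₁)` built from the two observables. The pair is
compatible exactly if some `Z` is at least the negative of the first two and at most the last two;
`Z` then gives the mean of the product of both outcomes. -/
noncomputable def chshOperator (A : Fin 2 → POVM H 2) : Fin 4 → H →L[ℂ] H :=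
  ![1 - ((A 0).observable + (A 1).observable), 1 + ((A 0).observable + (A 1).observable),
    1 - ((A 0).observable - (A 1).observable), 1 + ((A 0).observable - (A 1).observable)]

/-- The sum of the four expectations is `2 ‖ψ‖ ^ 2` minus the value of the CHSH expression. -/
lemma violatesCHSH_of_sum_expectation_neg {K : Type*} [NormedAddCommGroup K]
    [InnerProductSpace ℂ K] [CompleteSpace K] (A : Fin 2 → POVM H 2) (B : Fin 2 → POVM K 2)
    (ψ : H ⊗[ℂ] K) (hψ : ‖ψ‖ = 1)
    (h : expectation ψ (chshOperator A 0) ((B 0).effect 0) +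
      expectation ψ (chshOperator A 1) ((B 0).effect 1) +
      expectation ψ (chshOperator A 2) ((B 1).effect 0) +
      expectation ψ (chshOperator A 3) ((B 1).effect 1) < 0) :
    ViolatesCHSH (behavior A B ψ) := by
  refine ⟨1, 1, lt_of_lt_of_le ?_ (le_abs_self _)⟩
  have hone : ∀ y, expectation ψ 1 ((B y).effect 0) + expectation ψ 1 ((B y).effect 1) = 1 := by
    intro y
    rw [← map_add, ← Fin.sum_univ_two (fun b => (B y).effect b), (B y).sum_effect,
      expectation_one_one, hψ, one_pow]
  have h0 := hone 0
  have h1 := hone 1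
  simp only [chshOperator, POVM.observable, Matrix.cons_val, map_add, map_sub,
    LinearMap.add_apply, LinearMap.sub_apply] at h
  simp only [correlator, behavior_eq_expectation, Fin.sum_univ_two]
  norm_num
  linarith

lemma canViolateCHSH_of_sum_expectation_neg {m : ℕ} (A : Fin 2 → POVM H 2)
    (B : Fin 2 → POVM (EuclideanSpace ℂ (Fin m)) 2) (ψ : H ⊗[ℂ] EuclideanSpace ℂ (Fin m))
    (h : expectation ψ (chshOperator A 0) ((B 0).effect 0) +
      expectation ψ (chshOperator A 1) ((B 0).effect 1) +
      expectation ψ (chshOperator A 2) ((B 1).effect 0) +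
      expectation ψ (chshOperator A 3) ((B 1).effect 1) < 0) :
    CanViolateCHSH A := by
  have hψ : ψ ≠ 0 := by
    rintro rfl
    simp [expectation_apply] at h
  have hn : 0 < ‖ψ‖ := norm_pos_iff.2 hψ
  have hone : ‖((‖ψ‖⁻¹ : ℝ) : ℂ) • ψ‖ = 1 := by
    rw [Complex.ofReal_inv]
    exact norm_smul_inv_norm (𝕜 := ℂ) hψ
  refine ⟨m, ((‖ψ‖⁻¹ : ℝ) : ℂ) • ψ, B, ?_, ?_⟩
  · exact hone
  · refine violatesCHSH_of_sum_expectation_neg A B _ hone ?_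
    simp only [expectation_smul_vector, ← mul_add]
    exact mul_neg_of_pos_of_neg (by positivity) h

/-- The real part of the trace pairing of the matrix `⟨v i, T (v j)⟩` with the transpose of the
operator `S` on the coordinate space. -/
noncomputable def tracePairing {n : ℕ} (v : Fin n → H) (T : H →L[ℂ] H) :
    (EuclideanSpace ℂ (Fin n) →L[ℂ] EuclideanSpace ℂ (Fin n)) →ₗ[ℝ] ℝ where
  toFun S := (∑ i, ∑ j, inner ℂ (v i) (T (v j)) *
    inner ℂ (EuclideanSpace.single i (1 : ℂ)) (S (EuclideanSpace.single j 1))).re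
  map_add' S S' := by
    simp only [add_apply, inner_add_right, mul_add, Finset.sum_add_distrib, Complex.add_re]
  map_smul' c S := by
    simp only [smul_apply, inner_smul_right_eq_smul, mul_smul_comm, ← Finset.smul_sum,
      Complex.smul_re, RingHom.id_apply]

omit [CompleteSpace H] in
/-- Steering: two decompositions of the same invertible positive operator are realized by two
measurements on one half of a common bipartite vector, the canonical purification. -/
theorem exists_steering {n : ℕ} (v : Fin n → H)
    (S : Fin 2 → Fin 2 → EuclideanSpace ℂ (Fin n) →L[ℂ] EuclideanSpace ℂ (Fin n))
    (hS : ∀ y b, 0 ≤ S y b) (R : EuclideanSpace ℂ (Fin n) →L[ℂ] EuclideanSpace ℂ (Fin n))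
    (hR : ∀ y, S y 0 + S y 1 = R) (hunit : IsUnit R) :
    ∃ (ψ : H ⊗[ℂ] EuclideanSpace ℂ (Fin n)) (B : Fin 2 → POVM (EuclideanSpace ℂ (Fin n)) 2),
      ∀ T y b, expectation ψ T ((B y).effect b) = tracePairing v T (S y b) := by
  have hR0 : 0 ≤ R := by rw [← hR 0]; exact add_nonneg (hS 0 0) (hS 0 1)
  obtain ⟨u, hu⟩ := (CFC.isUnit_sqrt_iff R hR0).2 hunit
  set C : EuclideanSpace ℂ (Fin n) →L[ℂ] EuclideanSpace ℂ (Fin n) := u.val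
  set D : EuclideanSpace ℂ (Fin n) →L[ℂ] EuclideanSpace ℂ (Fin n) := (u⁻¹).val
  have hCC : C * C = R := by rw [hu]; exact CFC.sqrt_mul_sqrt_self R hR0
  have hCD : C * D = 1 := u.mul_inv
  have hDC : D * C = 1 := u.inv_mul
  have hCs : IsSelfAdjoint C := by rw [hu]; exact (CFC.sqrt_nonneg R).isSelfAdjoint
  have hDs : IsSelfAdjoint D := by
    calc star D = star D * (C * D) := by rw [hCD, mul_one]
      _ = star (C * D) * D := by rw [star_mul, hCs.star_eq, mul_assoc]
      _ = D := by rw [hCD, star_one, one_mul]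
  let B : Fin 2 → POVM (EuclideanSpace ℂ (Fin n)) 2 := fun y =>
    { effect := fun b => D * S y b * D
      isPositive := fun b => (ContinuousLinearMap.nonneg_iff_isPositive _).1
        (hDs.conjugate_nonneg (hS y b))
      sum_effect := by
        rw [Fin.sum_univ_two, ← add_mul, ← mul_add, hR, ← hCC, ← mul_assoc, hDC, one_mul, hCD] }
  refine ⟨∑ i, v i ⊗ₜ[ℂ] C (EuclideanSpace.single i 1), B, fun T y b => ?_⟩
  have hentry : ∀ e e', inner ℂ (C e) ((D * S y b * D) (C e')) = inner ℂ e (S y b e') := by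
    intro e e'
    have h1 : (D * S y b * D) (C e') = (D * S y b) e' := by
      change (D * S y b * D * C) e' = _
      rw [mul_assoc _ D C, hDC, mul_one]
    rw [h1, ← ContinuousLinearMap.adjoint_inner_right, ← ContinuousLinearMap.star_eq_adjoint,
      hCs.star_eq]
    change inner ℂ e ((C * (D * S y b)) e') = _
    rw [← mul_assoc, hCD, one_mul]
  rw [expectation_apply]
  simp only [map_sum, TensorProduct.map_tmul, sum_inner, inner_sum, TensorProduct.inner_tmul,
    ContinuousLinearMap.coe_coe, B, hentry]
  rw [Finset.sum_comm]
  rfl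

/-- A balanced quadruple of positive finite-rank operators with negative trace against the CHSH
operators yields a CHSH violation. -/
theorem canViolateCHSH_of_balanced (A : Fin 2 → POVM H 2) (W : Fin 4 → H →₀ ℝ)
    (hW : ∀ i, 0 ≤ W i) (hbal : mixture (W 0 + W 1) = mixture (W 2 + W 3))
    (hneg : ∑ i, weightedMean (chshOperator A i) (W i) < 0) : CanViolateCHSH A := by
  classical
  let s : Finset H := Finset.univ.biUnion fun i => (W i).support
  let V : Submodule ℂ H := Submodule.span ℂ s
  have : FiniteDimensional ℂ V := FiniteDimensional.span_finset ℂ s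
  let n := Module.finrank ℂ V
  let bV : OrthonormalBasis (Fin n) ℂ V := stdOrthonormalBasis ℂ V
  let v : Fin n → H := fun i => bV i
  have hexp : ∀ x ∈ s, ∑ i, inner ℂ (v i) x • v i = x := by
    intro x hx
    have := congrArg Subtype.val (bV.sum_repr' ⟨x, Submodule.subset_span hx⟩)
    simpa [v] using this
  -- Coordinates of the conjugate vector, which account for the transposition of the state.
  let ξ : H → EuclideanSpace ℂ (Fin n) := fun x => WithLp.toLp 2 fun i => inner ℂ x (v i)
  let P : (H →₀ ℝ) →ₗ[ℝ] (EuclideanSpace ℂ (Fin n) →L[ℂ] EuclideanSpace ℂ (Fin n)) :=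
    Finsupp.linearCombination ℝ fun x => rankOne ℂ (ξ x) (ξ x)
  have hPpos : ∀ w, 0 ≤ w → 0 ≤ P w := by
    intro w hw
    refine Finset.sum_nonneg fun x _ => smul_nonneg (hw x) ?_
    exact (ContinuousLinearMap.nonneg_iff_isPositive _).2 (isPositive_rankOne_self _)
  have hentry : ∀ w i j, inner ℂ (EuclideanSpace.single i (1 : ℂ))
      (P w (EuclideanSpace.single j 1)) = inner ℂ (v j) (mixture w (v i)) := by
    intro w i j
    induction w using Finsupp.induction_linear with
    | zero => simp
    | add w w' h h' => simp only [map_add, add_apply, inner_add_right, h, h']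
    | single x c =>
      have : P (Finsupp.single x c) = c • rankOne ℂ (ξ x) (ξ x) :=
        Finsupp.linearCombination_single ..
      rw [this, mixture_single]
      simp [ξ, EuclideanSpace.inner_single_left, EuclideanSpace.inner_single_right]
      exact Or.inl (mul_comm _ _)
  have hPbal : P (W 0) + P (W 1) = P (W 2) + P (W 3) := by
    rw [← map_add, ← map_add]
    refine ContinuousLinearMap.coe_injective
      ((EuclideanSpace.basisFun (Fin n) ℂ).toBasis.ext fun j => ?_)
    refine InnerProductSpace.ext_inner_left_basis (𝕜 := ℂ)
      (EuclideanSpace.basisFun (Fin n) ℂ).toBasis fun i => ?_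
    simp only [OrthonormalBasis.coe_toBasis, EuclideanSpace.basisFun_apply,
      ContinuousLinearMap.coe_coe, hentry, hbal]
  have htrace : ∀ T i, tracePairing v T (P (W i)) = weightedMean T (W i) := by
    intro T i
    have hx : ∀ x ∈ s, tracePairing v T (rankOne ℂ (ξ x) (ξ x)) = (inner ℂ x (T x)).re := by
      intro x hx
      conv_rhs => rw [← hexp x hx]
      simp only [map_sum, map_smul, sum_inner, inner_sum, inner_smul_left, inner_smul_right,
        inner_conj_symm]
      change Complex.re _ = _
      congr 1
      rw [Finset.sum_comm]
      simp only [Finset.mul_sum]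
      refine Finset.sum_congr rfl fun i _ => Finset.sum_congr rfl fun j _ => ?_
      simp [ξ, EuclideanSpace.inner_single_left, EuclideanSpace.inner_single_right]
      ring
    have hsub : (W i).support ⊆ s := Finset.subset_biUnion_of_mem (fun i => (W i).support)
      (Finset.mem_univ i)
    simp only [P, weightedMean, Finsupp.linearCombination_apply, Finsupp.sum, map_sum, map_smul]
    exact Finset.sum_congr rfl fun x hxi => by rw [hx x (hsub hxi)]
  -- A small multiple of the identity makes the common sum of both decompositions invertible.
  set Q := ∑ i, weightedMean (chshOperator A i) (W i) with hQ
  set τ := tracePairing v 1 1 with hτ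
  obtain ⟨δ, hδ, hδQ⟩ : ∃ δ : ℝ, 0 < δ ∧ Q + 4 * δ * τ < 0 := by
    refine ⟨-Q / (4 * |τ| + 1), div_pos (by linarith) (by positivity), ?_⟩
    have h1 : -Q / (4 * |τ| + 1) * (4 * |τ| + 1) = -Q := div_mul_cancel₀ _ (by positivity)
    have h2 : 0 < -Q / (4 * |τ| + 1) := div_pos (by linarith) (by positivity)
    nlinarith [le_abs_self τ]
  let S : Fin 2 → Fin 2 → EuclideanSpace ℂ (Fin n) →L[ℂ] EuclideanSpace ℂ (Fin n) := fun y b =>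
    P (![![W 0, W 1], ![W 2, W 3]] y b) + δ • 1
  have hone : (0 : EuclideanSpace ℂ (Fin n) →L[ℂ] EuclideanSpace ℂ (Fin n)) ≤ δ • 1 :=
    smul_nonneg hδ.le
      (zero_le_one (α := EuclideanSpace ℂ (Fin n) →L[ℂ] EuclideanSpace ℂ (Fin n)))
  obtain ⟨ψ, B, hψ⟩ := exists_steering v S
    (fun y b => add_nonneg (hPpos _ (by fin_cases y <;> fin_cases b <;> exact hW _)) hone)
    (P (W 0) + P (W 1) + (2 * δ) • 1)
    (by
      intro y
      fin_cases y
      · change P (W 0) + δ • 1 + (P (W 1) + δ • 1) = _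
        module
      · rw [hPbal]
        change P (W 2) + δ • 1 + (P (W 3) + δ • 1) = _
        module)
    (by
      refine CStarAlgebra.isUnit_of_le ((2 * δ) • 1)
        (le_add_of_nonneg_left (add_nonneg (hPpos _ (hW 0)) (hPpos _ (hW 1)))) ?_
      exact IsStrictlyPositive.smul (by positivity) isStrictlyPositive_one)
  have hadd : ∀ T T' S', tracePairing v (T + T') S' =
      tracePairing v T S' + tracePairing v T' S' := by
    intro T T' S'
    simp only [tracePairing, LinearMap.coe_mk, AddHom.coe_mk, add_apply, inner_add_right, add_mul,
      Finset.sum_add_distrib, Complex.add_re]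
  have hsum : tracePairing v (chshOperator A 0) 1 + tracePairing v (chshOperator A 1) 1 +
      tracePairing v (chshOperator A 2) 1 + tracePairing v (chshOperator A 3) 1 = 4 * τ := by
    have h4 : chshOperator A 0 + chshOperator A 1 + chshOperator A 2 + chshOperator A 3 =
        1 + 1 + 1 + 1 := by
      simp only [chshOperator, Matrix.cons_val]
      abel
    simp only [← hadd, h4]
    simp only [hadd]
    ring
  refine canViolateCHSH_of_sum_expectation_neg A B ψ ?_
  rw [hψ, hψ, hψ, hψ]
  simp only [S, Matrix.cons_val, Matrix.cons_val', map_add, map_smul, smul_eq_mul, htrace]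
  rw [Fin.sum_univ_four] at hQ
  linear_combination hδQ + δ * hsum - hQ

end Violation

/-! ### Incompatible pairs violate a CHSH inequality -/

section Parent

variable {H : Type*} [NormedAddCommGroup H] [InnerProductSpace ℂ H] [CompleteSpace H]

lemma POVM.isSelfAdjoint_observable (A : POVM H 2) : IsSelfAdjoint A.observable :=
  (A.isPositive 0).isSelfAdjoint.sub (A.isPositive 1).isSelfAdjoint

lemma isSelfAdjoint_chshOperator (A : Fin 2 → POVM H 2) (i : Fin 4) :
    IsSelfAdjoint (chshOperator A i) := by
  have h0 := (A 0).isSelfAdjoint_observable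
  have h1 := (A 1).isSelfAdjoint_observable
  have hone : IsSelfAdjoint (1 : H →L[ℂ] H) := .one _
  fin_cases i
  · exact hone.sub (h0.add h1)
  · exact hone.add (h0.add h1)
  · exact hone.sub (h0.sub h1)
  · exact hone.add (h0.sub h1)

/-- `Z` is the correlation of the outcomes under the joint distribution; it determines the parent
POVM `(1 ± a₀ ± a₁ ± Z) / 4`, whose positivity is exactly the assumption. -/
theorem compatible_of_correlation (A : Fin 2 → POVM H 2) (Z : H →L[ℂ] H)
    (h₀ : (chshOperator A 0 + Z).IsPositive) (h₁ : (chshOperator A 1 + Z).IsPositive)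
    (h₂ : (chshOperator A 2 - Z).IsPositive) (h₃ : (chshOperator A 3 - Z).IsPositive) :
    Compatible A := by
  let T : Fin 4 → H →L[ℂ] H := ![chshOperator A 0 + Z, chshOperator A 1 + Z,
    chshOperator A 2 - Z, chshOperator A 3 - Z]
  have hT : ∀ l, (T l).IsPositive := by
    intro l
    fin_cases l <;> assumption
  let G : POVM H 4 :=
    { effect := fun l => (4⁻¹ : ℝ) • T l
      isPositive := fun l => (ContinuousLinearMap.nonneg_iff_isPositive _).1
        (smul_nonneg (by norm_num) ((ContinuousLinearMap.nonneg_iff_isPositive _).2 (hT l)))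
      sum_effect := by
        simp only [Fin.sum_univ_four, T, chshOperator, Matrix.cons_val]
        module }
  have hsum : ∀ x, (A x).effect 1 = 1 - (A x).effect 0 := fun x => by
    rw [← (A x).sum_effect, Fin.sum_univ_two]; abel
  -- Outcomes `0, 1, 2, 3` of the parent stand for the pairs `(1,1), (0,0), (1,0), (0,1)`.
  refine ⟨4, G, fun x l z => if z = (![![1, 0, 1, 0], ![1, 0, 0, 1]] : Fin 2 → Fin 4 → Fin 2) x l
    then 1 else 0, ?_, ?_, ?_⟩
  · intro x l z
    dsimp only
    split_ifs <;> norm_num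
  · intro x l
    simp
  · intro x z
    fin_cases x <;> fin_cases z <;>
      simp [Fin.sum_univ_four, G, T, chshOperator, POVM.observable, hsum] <;> module

/-- Wolf, Perez-Garcia and Fernandez: two incompatible two-outcome POVMs violate a CHSH
inequality. -/
theorem canViolateCHSH_of_not_compatible (A : Fin 2 → POVM H 2) (hA : ¬ Compatible A) :
    CanViolateCHSH A := by
  by_contra hv
  obtain ⟨z, hz⟩ := exists_functional_of_forall_balanced (chshOperator A) fun W hW hbal =>
    not_lt.1 fun hneg => hv (canViolateCHSH_of_balanced A W hW hbal hneg)
  have hone : ∀ x : H, (inner ℂ x x).re = ‖x‖ ^ 2 := fun x =>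
    inner_self_eq_norm_sq (𝕜 := ℂ) x
  obtain ⟨Z, hZ⟩ := exists_operator_of_functional z fun x => by
    obtain ⟨⟨h0, h1⟩, h2, h3⟩ := hz x
    simp only [chshOperator, Matrix.cons_val, add_apply, sub_apply, inner_add_right,
      inner_sub_right, Complex.add_re, Complex.sub_re, one_apply_eq_self, hone]
      at h0 h1 h2 h3
    rw [abs_le]
    constructor <;> linarith
  have hM : ∀ (i : Fin 4) x, inner ℂ (chshOperator A i x) x =
      ((inner ℂ x (chshOperator A i x)).re : ℂ) := by
    intro i x
    have hs := (isSelfAdjoint_chshOperator A i).isSymmetric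
    have h1 : inner ℂ (chshOperator A i x) x = inner ℂ x (chshOperator A i x) := hs x x
    rw [h1]
    refine (Complex.conj_eq_iff_re.1 ?_).symm
    rw [inner_conj_symm, h1]
  refine hA (compatible_of_correlation A Z ?_ ?_ ?_ ?_) <;>
    rw [ContinuousLinearMap.isPositive_iff_complex] <;> intro x <;>
    obtain ⟨⟨h0, h1⟩, h2, h3⟩ := hz x <;>
    simp only [add_apply, sub_apply, inner_add_left, inner_sub_left, hM, hZ, ← Complex.ofReal_add,
      ← Complex.ofReal_sub] <;>
    exact ⟨rfl, by assumption⟩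

end Parent

/-! ### Coarse-grainings -/

section CoarseGrainings

variable {H : Type*} [NormedAddCommGroup H] [InnerProductSpace ℂ H] [CompleteSpace H]

lemma compatible_of_forall_exists {X : Type*} {d : X → ℕ} {M : ∀ x, POVM H (d x)} {k : ℕ}
    (G : POVM H k)
    (h : ∀ x, ∃ p : Fin k → Fin (d x) → ℝ, (∀ l z, 0 ≤ p l z ∧ p l z ≤ 1) ∧
      (∀ l, ∑ z, p l z = 1) ∧ ∀ z, (M x).effect z = ∑ l, (p l z : ℂ) • G.effect l) :
    Compatible M := by
  choose p h1 h2 h3 using h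
  exact ⟨k, G, p, h1, h2, h3⟩

lemma Compatible.coarseGrain {X : Type*} {d e : X → ℕ} {M : ∀ x, POVM H (d x)}
    (hM : Compatible M) (f : ∀ x, Fin (d x) → Fin (e x)) :
    Compatible fun x => (M x).coarseGrain (f x) := by
  obtain ⟨k, G, p, hp, hp1, hMG⟩ := hM
  refine ⟨k, G, fun x l w => ∑ z with f x z = w, p x l z, ?_, ?_, ?_⟩
  · refine fun x l w => ⟨Finset.sum_nonneg fun z _ => (hp x l z).1, ?_⟩
    rw [← hp1 x l]
    exact Finset.sum_le_sum_of_subset_of_nonneg (Finset.filter_subset _ _)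
      fun z _ _ => (hp x l z).1
  · intro x l
    rw [← hp1 x l]
    exact Finset.sum_fiberwise Finset.univ (f x) (p x l)
  · intro x w
    simp only [POVM.coarseGrain, hMG, Complex.ofReal_sum, Finset.sum_smul]
    exact Finset.sum_comm

lemma POVM.coarseGrain_coarseGrain {d e r : ℕ} (M : POVM H d) (f : Fin d → Fin e)
    (g : Fin e → Fin r) : (M.coarseGrain f).coarseGrain g = M.coarseGrain (g ∘ f) := by
  simp only [POVM.coarseGrain, POVM.mk.injEq]
  funext v
  simp only [Function.comp_apply, Finset.sum_filter]
  have hw : ∀ w, (if g w = v then ∑ z, if f z = w then M.effect z else 0 else 0) =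
      ∑ z, if f z = w then (if g (f z) = v then M.effect z else 0) else 0 := by
    intro w
    split_ifs with hg
    · exact Finset.sum_congr rfl fun z _ => by split_ifs <;> simp_all
    · exact (Finset.sum_eq_zero fun z _ => by split_ifs <;> simp_all).symm
  simp only [hw]
  rw [Finset.sum_comm]
  simp

/-- The binary coarse-graining that only asks whether the outcome is `z`. -/
lemma POVM.isNontrivial_coarseGrain_ite {d : ℕ} (M : POVM H d) {z : Fin d}
    (h0 : M.effect z ≠ 0) (h1 : M.effect z ≠ 1) :
    (M.coarseGrain fun w => if w = z then (0 : Fin 2) else 1).IsNontrivial := by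
  set N := M.coarseGrain fun w => if w = z then (0 : Fin 2) else 1
  have hN0 : N.effect 0 = M.effect z := by
    simp [N, POVM.coarseGrain, Finset.filter_eq']
  intro w
  fin_cases w
  · exact fun h => h1 (hN0.symm.trans h)
  · intro h
    have hs := N.sum_effect
    rw [Fin.sum_univ_two, hN0, show N.effect 1 = 1 from h] at hs
    exact h0 (by simpa using hs)

lemma POVM.exists_effect_ne_zero [Nontrivial H] {d : ℕ} (M : POVM H d) :
    ∃ z, M.effect z ≠ 0 := by
  by_contra! h
  have := M.sum_effect
  simp [h] at this

/-- A measurement all of whose effects are `0` or `1` has a deterministic outcome and is hence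
compatible with every other one. -/
lemma exists_effect_of_not_compatible {d : Fin 2 → ℕ} {M : ∀ x, POVM H (d x)}
    (hM : ¬ Compatible M) (x : Fin 2) :
    ∃ z, (M x).effect z ≠ 0 ∧ (M x).effect z ≠ 1 := by
  by_contra! h
  apply hM
  rcases subsingleton_or_nontrivial H with hH | hH
  · have hT : ∀ S T : H →L[ℂ] H, S = T := fun S T => by ext; exact Subsingleton.elim _ _
    exact ⟨0, ⟨fun z => z.elim0, fun z => z.elim0, hT _ _⟩, fun _ l => l.elim0,
      fun _ l => l.elim0, fun _ l => l.elim0, fun _ _ => hT _ _⟩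
  obtain ⟨z₀, hz₀⟩ := (M x).exists_effect_ne_zero
  have hz1 := h z₀ hz₀
  have hz : ∀ z, z ≠ z₀ → (M x).effect z = 0 := by
    intro z hzz
    have hs := (M x).sum_effect
    rw [← Finset.add_sum_erase _ _ (Finset.mem_univ z₀), hz1, add_eq_left] at hs
    exact (Finset.sum_eq_zero_iff_of_nonneg fun w _ =>
      (ContinuousLinearMap.nonneg_iff_isPositive _).2 ((M x).isPositive w)).1 hs z
      (Finset.mem_erase.2 ⟨hzz, Finset.mem_univ z⟩)
  refine compatible_of_forall_exists (M (1 - x)) fun y => ?_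
  by_cases hy : y = 1 - x
  · subst hy
    refine ⟨fun l z => if l = z then 1 else 0, fun l z => ?_, fun l => by simp, fun z => by simp⟩
    dsimp only
    split_ifs <;> norm_num
  · obtain rfl : y = x := by
      fin_cases x <;> fin_cases y <;> simp_all
    refine ⟨fun l z => if z = z₀ then 1 else 0, fun l z => ?_, fun l => by simp, fun z => ?_⟩
    · dsimp only
      split_ifs <;> norm_num
    · by_cases hzz : z = z₀
      · simp [hzz, hz1, (M _).sum_effect]
      · simp [hzz, hz z hzz]

end CoarseGrainings

/-! ### Reduction to binary coarse-grainings -/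

section Characterization

variable {H : Type*} [NormedAddCommGroup H] [InnerProductSpace ℂ H] [CompleteSpace H]

lemma CanViolateCHSH.not_compatible {A : Fin 2 → POVM H 2} (hA : CanViolateCHSH A) :
    ¬ Compatible A := by
  obtain ⟨m, ψ, B, hψ, hv⟩ := hA
  exact fun hc => not_violatesCHSH_of_compatible hc B ψ hψ hv

lemma FullyIncompatible.exists_isNontrivial {d : Fin 2 → ℕ} {M : ∀ x, POVM H (d x)}
    (hM : FullyIncompatible M) :
    ∃ f : ∀ x, Fin (d x) → Fin 2, ∀ x, ((M x).coarseGrain (f x)).IsNontrivial := by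
  choose z h0 h1 using exists_effect_of_not_compatible hM.1
  exact ⟨_, fun x => (M x).isNontrivial_coarseGrain_ite (h0 x) (h1 x)⟩

/-- It is enough to test binary coarse-grainings, because every nontrivial POVM has a further
nontrivial binary coarse-graining. -/
theorem fullyIncompatible_of_binary {d : Fin 2 → ℕ} {M : ∀ x, POVM H (d x)}
    (hex : ∃ f : ∀ x, Fin (d x) → Fin 2, ∀ x, ((M x).coarseGrain (f x)).IsNontrivial)
    (h : ∀ f : ∀ x, Fin (d x) → Fin 2, (∀ x, ((M x).coarseGrain (f x)).IsNontrivial) →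
      ¬ Compatible fun x => (M x).coarseGrain (f x)) :
    FullyIncompatible M := by
  obtain ⟨f₀, hf₀⟩ := hex
  -- On the zero space every two-outcome POVM is trivial.
  have : Nontrivial H := by
    by_contra hH
    rw [not_nontrivial_iff_subsingleton] at hH
    exact hf₀ 0 0 (by ext; exact Subsingleton.elim _ _)
  refine ⟨fun hc => h f₀ hf₀ (hc.coarseGrain f₀), fun e f hf hc => ?_⟩
  choose w hw using fun x => ((M x).coarseGrain (f x)).exists_effect_ne_zero
  refine h (fun x => (fun v => if v = w x then (0 : Fin 2) else 1) ∘ f x) (fun x => ?_) ?_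
  · rw [← POVM.coarseGrain_coarseGrain]
    exact ((M x).coarseGrain (f x)).isNontrivial_coarseGrain_ite (hw x) (hf x (w x))
  · simp only [← POVM.coarseGrain_coarseGrain]
    exact hc.coarseGrain _

end Characterization

end CoarseGraining

theorem mainTheorem7 {H : Type*} [NormedAddCommGroup H] [InnerProductSpace ℂ H] [CompleteSpace H]
    (d : Fin 2 → ℕ) (M : ∀ x : Fin 2, CoarseGraining.POVM H (d x)) :
    (CoarseGraining.FullyIncompatible M ↔
      (∃ f : ∀ x : Fin 2, Fin (d x) → Fin 2,
        ∀ x, ((M x).coarseGrain (f x)).IsNontrivial) ∧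
      ∀ f : ∀ x : Fin 2, Fin (d x) → Fin 2,
        (∀ x, ((M x).coarseGrain (f x)).IsNontrivial) →
          CoarseGraining.CanViolateCHSH fun x => (M x).coarseGrain (f x)) ∧
    (∀ (H' K' : Type*) [NormedAddCommGroup H'] [InnerProductSpace ℂ H'] [CompleteSpace H']
      [NormedAddCommGroup K'] [InnerProductSpace ℂ K'] [CompleteSpace K']
      (A : Fin 2 → CoarseGraining.POVM H' 2) (B : Fin 2 → CoarseGraining.POVM K' 2)
      (ψ : H' ⊗[ℂ] K'), ‖ψ‖ = 1 →
        CoarseGraining.ViolatesCHSH (CoarseGraining.behavior A B ψ) →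
          ¬ CoarseGraining.Compatible A) := by
  refine ⟨⟨fun hM => ⟨hM.exists_isNontrivial, fun f hf => ?_⟩, fun ⟨hex, h⟩ => ?_⟩, ?_⟩
  · exact CoarseGraining.canViolateCHSH_of_not_compatible _ (hM.2 _ f hf)
  · exact CoarseGraining.fullyIncompatible_of_binary hex fun f hf => (h f hf).not_compatible
  · intro H' K' _ _ _ _ _ _ A B ψ hψ hv hc
    exact CoarseGraining.not_violatesCHSH_of_compatible hc B ψ hψ hv
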